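/- Let $\boldsymbol\alpha=(\alpha_1,\dots,\alpha_n)$ be a sequence of nonnegative integers, let $\mathcal R(\boldsymbol\alpha)$ be the set of all words over $X=\{1,\dots,n\}$ in which each letter $i$ occurs exactly $\alpha_i$ times, and let $U\subseteq X\times X$ be a relation (directed graph) on $X$. For a word $w=x_1x_2\cdots x_m$ over $X$ put $$\mathrm{inv}'_U\,w=\#\{(i,j): 1\le i<j\le m,\ (x_i,x_j)\in U\},\qquad \mathrm{maj}'_U\,w=\sum_{\substack{1\le i<m\\ (x_i,x_{i+1})\in U}} i .$$ A relation $V$ on $X$ is called bipartitional if there are an ordered sequence $(B_1,\dots,B_k)$ of nonempty pairwise disjoint sets with union $X$ and numbers $\beta_1,\dots,\beta_k\in\{0,1\}$ such that $(x,y)\in V$ if and only if either $x\in B_i$, $y\in B_j$ for some $i<j$, or $x,y\in B_i$ for some $i$ with $\beta_i=1$. The relation $U$ is called essentially bipartitional relative to $\boldsymbol\alpha$ if there are disjoint sets $I,J\subseteq X$ such that $\alpha_x=1$ for all $x\in I\cup J$ and $(U\setminus\{(x,x):x\in I\})\cup\{(x,x):x\in J\}$ is bipartitional. If $U$ is essentially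 bipartitional relative to $\boldsymbol\alpha$, then $\mathrm{inv}'_U$ and $\mathrm{maj}'_U$ are equidistributed on $\mathcal R(\boldsymbol\alpha)$, that is, for every integer $k \ge 0$ the numbers of $w\in\mathcal R(\boldsymbol\alpha)$ with $\mathrm{inv}'_U\,w=k$ and with $\mathrm{maj}'_U\,w=k$ are equal. If moreover every letter occurs, i.e. $\alpha_i\ge 1$ for $i=1,\dots,n$, then $\mathrm{inv}'_U$ and $\mathrm{maj}'_U$ are equidistributed on $\mathcal R(\boldsymbol\alpha)$ if and only if $U$ is essentially bipartitional relative to $\boldsymbol\alpha$. -/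

import Mathlib

/-- The set of words over the alphabet `X = {1, …, n}` (modelled by `Fin n`) in which each letter
`x` occurs exactly `α x` times. -/
def RearrangementClass {n : ℕ} (α : Fin n → ℕ) : Set (List (Fin n)) :=
  {w | ∀ x, w.count x = α x}

/-- A rearrangement class is finite (so that `Set.ncard` below is a genuine count). -/
theorem rearrangementClass_finite {n : ℕ} (α : Fin n → ℕ) : (RearrangementClass α).Finite := by
  refine ((∑ x, Multiset.replicate (α x) x : Multiset (Fin n)).lists.finite_toSet).subset ?_
  intro w hw
  simp only [Multiset.mem_lists_iff]
  ext x
  have h : w.count x = α x := hw x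
  simp [Multiset.count_sum', Multiset.count_replicate, h]

open Classical in
/-- Graphical inversion number of `w = x₁ x₂ … x_m`: the number of pairs of positions `i < j` with
`(x_i, x_j) ∈ U`. -/
noncomputable def graphInv {n : ℕ} (U : Set (Fin n × Fin n)) (w : List (Fin n)) : ℕ :=
  ∑ i : Fin w.length, ∑ j : Fin w.length, if i < j ∧ (w[i], w[j]) ∈ U then 1 else 0

open Classical in
/-- Graphical descent set of `w = x₁ x₂ … x_m`: the positions `i`, counted from `1`, such that
`x_{i+1}` exists and `(x_i, x_{i+1}) ∈ U`. The list `w` is indexed from `0`, so that `x_i` is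
`w[i - 1]` and `x_{i+1}` is `w[i]`. -/
noncomputable def graphDes {n : ℕ} (U : Set (Fin n × Fin n)) (w : List (Fin n)) : Finset ℕ :=
  {i ∈ Finset.Icc 1 w.length | ∃ h : i < w.length, (w[i - 1], w[i]) ∈ U}

/-- Graphical major index: the sum of the graphical descents. -/
noncomputable def graphMaj {n : ℕ} (U : Set (Fin n × Fin n)) (w : List (Fin n)) : ℕ :=
  ∑ i ∈ graphDes U w, i

/-- Two statistics are equidistributed on a set of words if each value is taken by both of them
equally often. -/
def EquidistributedOn {n : ℕ} (f g : List (Fin n) → ℕ) (R : Set (List (Fin n))) : Prop :=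
  ∀ k : ℕ, {w ∈ R | f w = k}.ncard = {w ∈ R | g w = k}.ncard

/-- An ordered bipartition of `X`: a sequence of nonempty, pairwise disjoint blocks with union `X`,
each of them underlined or not. -/
structure OrderedBipartition (X : Type*) where
  /-- the number of blocks -/
  k : ℕ
  /-- the blocks -/
  block : Fin k → Set X
  /-- the indicator of the underlined blocks -/
  underlined : Fin k → Bool
  nonempty : ∀ i, (block i).Nonempty
  disjoint : ∀ i j, i ≠ j → Disjoint (block i) (block j)
  cover : ⋃ i, block i = Set.univ

/-- `U` is bipartitional if it is the relation of some ordered bipartition. -/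
def IsBipartitional {X : Type*} (U : Set (X × X)) : Prop :=
  ∃ P : OrderedBipartition X, ∀ x y : X, (x, y) ∈ U ↔
    (∃ i j, i < j ∧ x ∈ P.block i ∧ y ∈ P.block j) ∨
      (∃ i, P.underlined i = true ∧ x ∈ P.block i ∧ y ∈ P.block i)

/-- `U` is essentially bipartitional relative to `α` if it becomes bipartitional after removing the
loops at `I` and adding the loops at `J`, for some disjoint sets `I`, `J` of letters of
multiplicity `1`. -/
def IsEssentiallyBipartitional {n : ℕ} (α : Fin n → ℕ) (U : Set (Fin n × Fin n)) : Prop :=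
  ∃ I J : Set (Fin n), Disjoint I J ∧ (∀ x ∈ I ∪ J, α x = 1) ∧
    IsBipartitional ((U \ {p | ∃ x ∈ I, p = (x, x)}) ∪ {p | ∃ x ∈ J, p = (x, x)})

/-! A relation on a finite set is bipartitional exactly when it and its complement are both
transitive (`isBipartitional_iff_transitive`). Loops at letters of multiplicity 1 affect neither
statistic, since such a letter never meets itself at two positions. Sufficiency: under the two
transitivities, Foata's second fundamental transformation works with the relation in place of `>`.
It is an injective rearrangement of words carrying the major index to the inversion number
(`revInv_foataMap`). Necessity: equidistribution forces equal second moments. The positions of a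
random word are exchangeable, so the difference of the second moments is a positive constant times
the sum over words of a defect depending on three letters (`sum_sq_maj_sub_sum_sq_inv`). Symmetrised
over the orderings of the three letters, the defect is nonnegative, and where it vanishes both
transitivities hold. Hence they hold for every triple of letters that fits in a word; only the loops
at letters of multiplicity 1 remain free, and these can be chosen suitably. -/

/-! ### The two statistics as sums over pairs of positions. -/

open Classical in
/-- The indicator of the event that the letters at the positions `i` and `j` of `w` are related
by `U`. -/
noncomputable def pairInd {n : ℕ} (U : Set (Fin n × Fin n)) (w : List (Fin n)) (i j : ℕ) : ℕ :=
  if ∃ a b, w[i]? = some a ∧ w[j]? = some b ∧ (a, b) ∈ U then 1 else 0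

theorem graphInv_eq_sum_pairInd {n : ℕ} (U : Set (Fin n × Fin n)) (w : List (Fin n)) :
    graphInv U w = ∑ j ∈ Finset.range w.length, ∑ i ∈ Finset.range j, pairInd U w i j := by
  classical
  unfold graphInv
  rw [Finset.sum_comm, Finset.sum_range]
  refine Finset.sum_congr rfl fun j _ => ?_
  have h : Finset.range (j : ℕ) = (Finset.range w.length).filter (· < (j : ℕ)) := by
    ext i
    simp only [Finset.mem_range, Finset.mem_filter]
    have := j.2
    omega
  rw [h, Finset.sum_filter, Finset.sum_range]
  refine Finset.sum_congr rfl fun i _ => ?_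
  by_cases hij : i < j <;> simp [pairInd, hij]

/-- With letters indexed from 0, a descent at the 1-based position `j` compares the entries `j - 1`
and `j`. The weight `j` kills the term `j = 0`, where `j - 1` truncates. -/
theorem graphMaj_eq_sum_pairInd {n : ℕ} (U : Set (Fin n × Fin n)) (w : List (Fin n)) :
    graphMaj U w = ∑ j ∈ Finset.range w.length, j * pairInd U w (j - 1) j := by
  classical
  unfold graphMaj graphDes
  have h : ∑ j ∈ Finset.range w.length, j * pairInd U w (j - 1) j =
      ∑ j ∈ Finset.range (w.length + 1), j * pairInd U w (j - 1) j := by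
    rw [Finset.sum_range_succ]
    simp [pairInd]
  rw [h, Finset.sum_filter]
  have hsub : Finset.Icc 1 w.length ⊆ Finset.range (w.length + 1) := by
    intro i
    simp only [Finset.mem_Icc, Finset.mem_range]
    omega
  rw [← Finset.sum_subset hsub (f := fun j => j * pairInd U w (j - 1) j)]
  · refine Finset.sum_congr rfl fun i hi => ?_
    by_cases hw : i < w.length
    · have : i - 1 < w.length := by omega
      simp [pairInd, hw, this]
    · simp [pairInd, hw]
  · intro i hi hi'
    simp only [Finset.mem_Icc, Finset.mem_range] at hi hi'
    obtain rfl : i = 0 := by omega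
    simp

theorem pairInd_append_singleton_of_lt {n : ℕ} (U : Set (Fin n × Fin n)) (w : List (Fin n))
    (x : Fin n) {i j : ℕ} (hi : i < w.length) (hj : j < w.length) :
    pairInd U (w ++ [x]) i j = pairInd U w i j := by
  rw [pairInd, pairInd, List.getElem?_append_left hi, List.getElem?_append_left hj]

theorem graphInv_append_singleton {n : ℕ} (U : Set (Fin n × Fin n)) (w : List (Fin n))
    (x : Fin n) : graphInv U (w ++ [x]) =
      graphInv U w + ∑ i ∈ Finset.range w.length, pairInd U (w ++ [x]) i w.length := by
  rw [graphInv_eq_sum_pairInd, graphInv_eq_sum_pairInd, List.length_append, List.length_singleton,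
    Finset.sum_range_succ]
  congr 1
  refine Finset.sum_congr rfl fun j hj => Finset.sum_congr rfl fun i hi => ?_
  rw [Finset.mem_range] at hi hj
  exact pairInd_append_singleton_of_lt U w x (hi.trans hj) hj

theorem graphMaj_append_singleton {n : ℕ} (U : Set (Fin n × Fin n)) (w : List (Fin n))
    (x : Fin n) : graphMaj U (w ++ [x]) =
      graphMaj U w + w.length * pairInd U (w ++ [x]) (w.length - 1) w.length := by
  rw [graphMaj_eq_sum_pairInd, graphMaj_eq_sum_pairInd, List.length_append, List.length_singleton,
    Finset.sum_range_succ]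
  congr 1
  refine Finset.sum_congr rfl fun j hj => ?_
  rw [Finset.mem_range] at hj
  rw [pairInd_append_singleton_of_lt U w x (by omega) hj]

open Classical in
theorem sum_pairInd_append_singleton {n : ℕ} (U : Set (Fin n × Fin n)) (w : List (Fin n))
    (x : Fin n) : ∑ i ∈ Finset.range w.length, pairInd U (w ++ [x]) i w.length =
      w.countP (fun a => (a, x) ∈ U) := by
  -- The extra suffix `t` keeps the last letter `x` in place while the induction peels letters off
  -- the end of `v`.
  have key : ∀ (v t : List (Fin n)),
      ∑ i ∈ Finset.range v.length, pairInd U (v ++ t ++ [x]) i (v.length + t.length) =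
        v.countP (fun a => (a, x) ∈ U) := by
    intro v
    induction v using List.reverseRecOn with
    | nil => simp
    | append_singleton v a ih =>
      intro t
      have h := ih (a :: t)
      rw [List.length_append, List.length_singleton, Finset.sum_range_succ, List.countP_append]
      have e : v ++ a :: t ++ [x] = v ++ [a] ++ t ++ [x] := by simp
      have e' : v.length + (a :: t).length = v.length + 1 + t.length := by
        simp only [List.length_cons]; omega
      rw [e, e'] at h
      rw [h]
      congr 1
      have h1 : (v ++ [a] ++ t ++ [x])[v.length]? = some a := by simp
      have h2 : (v ++ [a] ++ t ++ [x])[v.length + 1 + t.length]? = some x := by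
        rw [List.getElem?_append_right (by simp; omega)]
        simp [show v.length + 1 + t.length - (v.length + (t.length + 1)) = 0 by omega]
      unfold pairInd
      rw [h1, h2]
      by_cases hax : (a, x) ∈ U <;> simp [hax]
  simpa using key w []

/-! ### Foata's second fundamental transformation, on reversed words. -/

section Foata

variable {X : Type*}

/-- On a word whose first letter satisfies `p`, move every letter satisfying `p` to the end of the
run of letters failing `p` that follows it. -/
def runShift (p : X → Prop) [DecidablePred p] : List X → List X
  | [] => []
  | [b] => [b]
  | b :: c :: l => if p c then b :: runShift p (c :: l) else c :: runShift p (b :: l)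
termination_by l => l.length

/-- The inverse of `runShift` on the words whose last letter satisfies `p`. -/
def runUnshift (p : X → Prop) [DecidablePred p] : List X → List X
  | [] => []
  | a :: l => if p a then a :: runUnshift p l else
      match runUnshift p l with
      | [] => [a]
      | b :: l' => b :: a :: l'

theorem runShift_perm (p : X → Prop) [DecidablePred p] (l : List X) :
    (runShift p l).Perm l := by
  fun_induction runShift p l with
  | case1 => rfl
  | case2 => rfl
  | case3 b c l hc ih => exact ih.cons b
  | case4 b c l hc ih => exact (ih.cons c).trans (List.Perm.swap b c l)

theorem runUnshift_runShift (p : X → Prop) [DecidablePred p] (l : List X)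
    (h : ∀ a ∈ l.head?, p a) : runUnshift p (runShift p l) = l := by
  fun_induction runShift p l with
  | case1 => rfl
  | case2 b =>
    simp [runUnshift]
  | case3 b c l hc ih =>
    have hb : p b := h b (by simp)
    simp [runUnshift, hb, ih (by simpa using hc)]
  | case4 b c l hc ih =>
    simp [runUnshift, hc, ih (by simpa using h)]

theorem getLast?_runShift (p : X → Prop) [DecidablePred p] (l : List X)
    (h : ∀ a ∈ l.head?, p a) : ∀ a ∈ (runShift p l).getLast?, p a := by
  fun_induction runShift p l with
  | case1 => simp
  | case2 b => simpa using h
  | case3 b c l hc ih =>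
    have hne : runShift p (c :: l) ≠ [] := fun h0 => by
      have := (runShift_perm p (c :: l)).length_eq
      simp [h0] at this
    rw [List.getLast?_cons, List.getLast?_eq_some_getLast hne]
    rw [List.getLast?_eq_some_getLast hne] at ih
    simpa using ih (by simpa using hc)
  | case4 b c l hc ih =>
    have hne : runShift p (b :: l) ≠ [] := fun h0 => by
      have := (runShift_perm p (b :: l)).length_eq
      simp [h0] at this
    rw [List.getLast?_cons, List.getLast?_eq_some_getLast hne]
    rw [List.getLast?_eq_some_getLast hne] at ih
    simpa using ih (by simpa using h)

variable (V : X → X → Prop) [DecidableRel V]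

/-- The inversion number of the reversal of a word. -/
def revInv : List X → ℕ
  | [] => 0
  | x :: w => w.countP (fun a => V a x) + revInv w

/-- The major index of the reversal of a word. -/
def revMaj : List X → ℕ
  | [] => 0
  | [_] => 0
  | x :: a :: w => (if V a x then w.length + 1 else 0) + revMaj (a :: w)

/-- Each letter failing `p` is crossed by exactly one letter satisfying `p`, and each crossing
creates one inversion. In `revInv_runShift_of_not_rel` each crossing destroys one. -/
theorem revInv_runShift_of_rel (p : X → Prop) [DecidablePred p]
    (h : ∀ b u, p b → ¬ p u → V b u ∧ ¬ V u b) (l : List X) (hl : ∀ a ∈ l.head?, p a) :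
    revInv V (runShift p l) = revInv V l + l.countP (fun a => ¬ p a) := by
  fun_induction runShift p l with
  | case1 => simp [revInv]
  | case2 b =>
    have hb : p b := by simpa using hl
    simp [revInv, hb]
  | case3 b c l hc ih =>
    have hb : p b := hl b (by simp)
    have ih := ih (by simpa using hc)
    rw [revInv, (runShift_perm p (c :: l)).countP_eq, ih, revInv.eq_2 V b (c :: l),
      List.countP_cons_of_neg (a := b) (by simpa using hb)]
    omega
  | case4 b c l hc ih =>
    have hb : p b := hl b (by simp)
    have ih := ih (by simpa using hl)
    obtain ⟨h1, h2⟩ := h b c hb hc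
    rw [revInv, (runShift_perm p (b :: l)).countP_eq, ih]
    simp only [revInv, List.countP_cons, h1, h2, hb, hc, decide_true, decide_false]
    simp
    omega

theorem revInv_runShift_of_not_rel (p : X → Prop) [DecidablePred p]
    (h : ∀ b u, p b → ¬ p u → V u b ∧ ¬ V b u) (l : List X) (hl : ∀ a ∈ l.head?, p a) :
    revInv V (runShift p l) + l.countP (fun a => ¬ p a) = revInv V l := by
  fun_induction runShift p l with
  | case1 => simp [revInv]
  | case2 b =>
    have hb : p b := by simpa using hl
    simp [revInv, hb]
  | case3 b c l hc ih =>
    have hb : p b := hl b (by simp)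
    have ih := ih (by simpa using hc)
    rw [revInv, (runShift_perm p (c :: l)).countP_eq, revInv.eq_2 V b (c :: l),
      List.countP_cons_of_neg (a := b) (by simpa using hb)]
    omega
  | case4 b c l hc ih =>
    have hb : p b := hl b (by simp)
    have ih := ih (by simpa using hl)
    obtain ⟨h1, h2⟩ := h b c hb hc
    rw [revInv, (runShift_perm p (b :: l)).countP_eq]
    simp only [revInv, List.countP_cons, h1, h2, hb, hc, decide_true, decide_false] at ih ⊢
    simp at ih ⊢
    omega

/-- The step of Foata's second fundamental transformation, on reversed words: shift the letters
whose relation to `x` is that of the first letter. -/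
def foataStep (x : X) : List X → List X
  | [] => []
  | h :: w => runShift (fun a => V a x ↔ V h x) (h :: w)

theorem foataStep_perm (x : X) (l : List X) : (foataStep V x l).Perm l := by
  cases l with
  | nil => rfl
  | cons h w => exact runShift_perm _ _

theorem foataStep_injective (x : X) : Function.Injective (foataStep V x) := by
  intro l l' h
  cases l with
  | nil =>
    have := (foataStep_perm V x l').length_eq
    rw [← h] at this
    simpa [foataStep, eq_comm] using this
  | cons a w =>
    cases l' with
    | nil =>
      have := (foataStep_perm V x (a :: w)).length_eq
      rw [h] at this
      simp [foataStep] at this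
    | cons b w' =>
      have hne : foataStep V x (a :: w) ≠ [] := fun h0 => by
        have := (foataStep_perm V x (a :: w)).length_eq
        simp [h0] at this
      have h1 := getLast?_runShift (fun c => V c x ↔ V a x) (a :: w) (by simp)
      have h2 := getLast?_runShift (fun c => V c x ↔ V b x) (b :: w') (by simp)
      change ∀ c ∈ (foataStep V x (a :: w)).getLast?, _ at h1
      change ∀ c ∈ (foataStep V x (b :: w')).getLast?, _ at h2
      rw [← h] at h2
      rw [List.getLast?_eq_some_getLast hne] at h1 h2
      -- The last letter of the image reveals which class was shifted, so both words were treated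
      -- with the same predicate and `runUnshift` recovers them.
      have hab : V a x ↔ V b x := (h1 _ rfl).symm.trans (h2 _ rfl)
      have e1 := runUnshift_runShift (fun c => V c x ↔ V a x) (a :: w) (by simp)
      have e2 := runUnshift_runShift (fun c => V c x ↔ V a x) (b :: w') (by simp [hab])
      have e3 : foataStep V x (b :: w') = runShift (fun c => V c x ↔ V a x) (b :: w') := by
        unfold foataStep
        simp only [hab]
      rw [← e1, ← e2, ← e3, ← h, foataStep]

/-- Foata's second fundamental transformation on reversed words. -/
def foataMap : List X → List X
  | [] => []
  | x :: w => x :: foataStep V x (foataMap w)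

theorem foataMap_perm (l : List X) : (foataMap V l).Perm l := by
  induction l with
  | nil => rfl
  | cons x w ih => exact ((foataStep_perm V x _).trans ih).cons x

theorem foataMap_injective : Function.Injective (foataMap V) := by
  intro l
  induction l with
  | nil =>
    intro l' h
    cases l' with
    | nil => rfl
    | cons y w' => simp [foataMap] at h
  | cons x w ih =>
    intro l' h
    cases l' with
    | nil => simp [foataMap] at h
    | cons y w' =>
      simp only [foataMap, List.cons.injEq] at h
      obtain ⟨rfl, h⟩ := h
      rw [ih (foataStep_injective V x h)]

theorem revInv_foataMap (htrans : ∀ x y z, V x y → V y z → V x z)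
    (hco : ∀ x y z, ¬ V x y → ¬ V y z → ¬ V x z) (l : List X) :
    revInv V (foataMap V l) = revMaj V l := by
  induction l with
  | nil => rfl
  | cons x w ih =>
    cases w with
    | nil => simp [foataMap, foataStep, revInv, revMaj]
    | cons h t =>
      have hstep : ∀ b u, V b x → ¬ V u x → V b u ∧ ¬ V u b := fun b u hb hu =>
        ⟨by_contra fun h0 => hco b u x h0 hu hb, fun h0 => hu (htrans u b x h0 hb)⟩
      rw [foataMap, revInv, (foataStep_perm V x _).countP_eq]
      set s := foataStep V h (foataMap V t) with hs
      -- The map fixes the head, so the relation of `h` to `x`, which decides the descent, also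
      -- decides which class is shifted.
      have hm : foataMap V (h :: t) = h :: s := rfl
      have hlen : s.length = t.length := by
        have := (foataMap_perm V (h :: t)).length_eq
        rw [hm] at this
        simpa using this
      rw [hm] at ih ⊢
      have hcnt := List.length_eq_countP_add_countP (fun a => decide (V a x)) (l := h :: s)
      rw [List.length_cons, hlen] at hcnt
      -- If `h` is related to `x`, the inversions with `x` count the shifted letters and the shift
      -- adds the number of the others: in total the length of the prefix, which is the weight of
      -- the descent. Otherwise the shift removes exactly the inversions that `x` creates.
      by_cases hv : V h x
      · have e := revInv_runShift_of_rel V (fun a => V a x ↔ V h x)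
          (fun b u hb hu => hstep b u (hb.2 hv) (by simpa [hv] using hu)) (h :: s) (by simp)
        rw [revMaj, if_pos hv, foataStep, e, ih]
        simp only [hv, iff_true, decide_not] at *
        simp only [decide_eq_true_eq] at hcnt
        omega
      · have e := revInv_runShift_of_not_rel V (fun a => V a x ↔ V h x)
          (fun b u hb hu => hstep u b (by simpa [hv] using hu) (by simpa [hv] using hb))
          (h :: s) (by simp)
        rw [revMaj, if_neg hv, foataStep, ← ih, ← e]
        simp only [hv, iff_false, not_not]
        omega

end Foata

/-! ### Bipartitional relations, rank functions and transitivity. -/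

theorem IsBipartitional.of_rank {X : Type*} [Fintype X] {V : Set (X × X)} (f : X → ℕ)
    (b : ℕ → Prop) (h : ∀ x y, (x, y) ∈ V ↔ f x < f y ∨ f x = f y ∧ b (f x)) :
    IsBipartitional V := by
  classical
  let e := (Finset.univ.image f).orderIsoOfFin rfl
  have hf : ∀ x, f x ∈ Finset.univ.image f := fun x =>
    Finset.mem_image_of_mem f (Finset.mem_univ x)
  have hlt : ∀ i j, i < j ↔ (e i : ℕ) < e j := fun i j => by
    rw [← e.lt_iff_lt, Subtype.coe_lt_coe]
  refine ⟨⟨_, fun i => {x | f x = e i}, fun i => decide (b (e i)), ?_, ?_, ?_⟩, ?_⟩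
  · intro i
    obtain ⟨x, -, hx⟩ := Finset.mem_image.1 (e i).2
    exact ⟨x, hx⟩
  · intro i j hij
    rw [Set.disjoint_left]
    intro x hx hx'
    exact hij (e.injective (Subtype.ext (hx.symm.trans hx')))
  · refine Set.eq_univ_of_forall fun x => Set.mem_iUnion.2 ⟨e.symm ⟨f x, hf x⟩, ?_⟩
    simp
  · intro x y
    rw [h]
    simp only [Set.mem_ofPred_eq, decide_eq_true_eq]
    refine or_congr ⟨fun hxy => ?_, ?_⟩ ⟨fun hxy => ?_, ?_⟩
    · refine ⟨e.symm ⟨f x, hf x⟩, e.symm ⟨f y, hf y⟩, ?_, by simp, by simp⟩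
      rw [hlt]
      simpa using hxy
    · rintro ⟨i, j, hij, hx, hy⟩
      rw [hx, hy]
      exact (hlt i j).1 hij
    · exact ⟨e.symm ⟨f x, hf x⟩, by simpa using hxy.2, by simp, by simpa using hxy.1.symm⟩
    · rintro ⟨i, hi, hx, hy⟩
      exact ⟨hx.trans hy.symm, by rwa [hx]⟩

theorem IsBipartitional.exists_rank {X : Type*} {V : Set (X × X)} (h : IsBipartitional V) :
    ∃ (f : X → ℕ) (b : ℕ → Prop), ∀ x y, (x, y) ∈ V ↔ f x < f y ∨ f x = f y ∧ b (f x) := by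
  obtain ⟨P, hP⟩ := h
  have hex : ∀ x, ∃ i, x ∈ P.block i := fun x => by
    have : x ∈ ⋃ i, P.block i := P.cover ▸ Set.mem_univ x
    exact Set.mem_iUnion.1 this
  choose g hg using hex
  have huniq : ∀ x i, x ∈ P.block i → i = g x := fun x i hi => by
    by_contra hne
    exact Set.disjoint_left.1 (P.disjoint i (g x) hne) hi (hg x)
  refine ⟨fun x => g x, fun i => ∃ j : Fin P.k, (j : ℕ) = i ∧ P.underlined j = true, ?_⟩
  intro x y
  rw [hP]
  refine or_congr ⟨?_, fun hxy => ⟨_, _, hxy, hg x, hg y⟩⟩ ⟨?_, ?_⟩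
  · rintro ⟨i, j, hij, hx, hy⟩
    rw [huniq x i hx, huniq y j hy] at hij
    exact hij
  · rintro ⟨i, hi, hx, hy⟩
    exact ⟨congrArg Fin.val ((huniq x i hx).symm.trans (huniq y i hy)), i,
      congrArg Fin.val (huniq x i hx), hi⟩
  · rintro ⟨hxy, j, hj, hu⟩
    obtain rfl : j = g x := Fin.ext hj
    exact ⟨_, hu, hg x, (Fin.ext hxy : g x = g y) ▸ hg y⟩

/-- A relation on a finite set is bipartitional if and only if both it and its complement are
transitive. -/
theorem isBipartitional_iff_transitive {X : Type*} [Fintype X] {V : Set (X × X)} :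
    IsBipartitional V ↔ (∀ x y z, (x, y) ∈ V → (y, z) ∈ V → (x, z) ∈ V) ∧
      (∀ x y z, (x, y) ∉ V → (y, z) ∉ V → (x, z) ∉ V) := by
  classical
  constructor
  · intro h
    obtain ⟨f, b, hf⟩ := h.exists_rank
    simp only [hf]
    constructor <;> intro x y z h1 h2
    · rcases h1 with h1 | ⟨h1, h1'⟩ <;> rcases h2 with h2 | ⟨h2, h2'⟩
      · exact Or.inl (h1.trans h2)
      · exact Or.inl (h2 ▸ h1)
      · exact Or.inl (h1 ▸ h2)
      · exact Or.inr ⟨h1.trans h2, h1'⟩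
    · push Not at h1 h2 ⊢
      refine ⟨h2.1.trans h1.1, fun hxz => ?_⟩
      exact h1.2 (le_antisymm (hxz.trans_le h2.1) h1.1)
  · rintro ⟨ht, hc⟩
    -- The number of strict predecessors serves as rank: it increases along one-way pairs and agrees
    -- on pairs related both ways or neither way.
    let S : X → Finset X := fun x => Finset.univ.filter fun z => (z, x) ∈ V ∧ (x, z) ∉ V
    have hlt : ∀ x y, (x, y) ∈ V → (y, x) ∉ V → (S x).card < (S y).card := by
      intro x y h1 h2
      refine Finset.card_lt_card (Finset.ssubset_iff_of_subset ?_ |>.2 ⟨x, ?_, ?_⟩)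
      · intro z hz
        simp only [S, Finset.mem_filter, Finset.mem_univ, true_and] at hz ⊢
        exact ⟨ht _ _ _ hz.1 h1, hc _ _ _ h2 hz.2⟩
      · simp [S, h1, h2]
      · simp [S]
    have hiff : ∀ x y, ((x, y) ∈ V ↔ (y, x) ∈ V) → ∀ z, (x, z) ∈ V ∧ (z, x) ∉ V →
        (y, z) ∈ V ∧ (z, y) ∉ V := by
      intro x y hxy z ⟨h1, h2⟩
      by_cases h : (x, y) ∈ V
      · exact ⟨ht _ _ _ (hxy.1 h) h1, fun h3 => h2 (ht _ _ _ h3 (hxy.1 h))⟩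
      · exact ⟨by_contra fun h3 => hc _ _ _ h h3 h1, hc _ _ _ h2 h⟩
    have hiff' : ∀ x y, ((x, y) ∈ V ↔ (y, x) ∈ V) → ∀ z, (z, x) ∈ V ∧ (x, z) ∉ V →
        (z, y) ∈ V ∧ (y, z) ∉ V := by
      intro x y hxy z ⟨h1, h2⟩
      by_cases h : (x, y) ∈ V
      · exact ⟨ht _ _ _ h1 h, fun h3 => h2 (ht _ _ _ h h3)⟩
      · exact ⟨by_contra fun h3 => hc _ _ _ h3 (fun h4 => h (hxy.2 h4)) h1,
          hc _ _ _ (fun h4 => h (hxy.2 h4)) h2⟩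
    have heq : ∀ x y, ((x, y) ∈ V ↔ (y, x) ∈ V) → S x = S y := by
      intro x y hxy
      ext z
      simp only [S, Finset.mem_filter, Finset.mem_univ, true_and]
      exact ⟨hiff' x y hxy z, hiff' y x hxy.symm z⟩
    have hcases : ∀ x y, (S x).card = (S y).card → ((x, y) ∈ V ↔ (y, x) ∈ V) := by
      intro x y h
      by_contra hne
      by_cases h1 : (x, y) ∈ V
      · have := hlt x y h1 (by tauto)
        omega
      · have := hlt y x (by tauto) h1
        omega
    refine IsBipartitional.of_rank (fun x => (S x).card)
      -- A block is underlined as soon as it contains one loop; the two transitivities then relate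
      -- all its pairs.
      (fun i => ∃ x, (S x).card = i ∧ (x, x) ∈ V) fun x y => ⟨fun hxy => ?_, ?_⟩
    · by_cases hyx : (y, x) ∈ V
      · exact Or.inr ⟨by rw [heq x y (by tauto)], x, rfl, ht _ _ _ hxy hyx⟩
      · exact Or.inl (hlt x y hxy hyx)
    · rintro (h | ⟨h, z, hz, hzz⟩)
      · by_contra hxy
        by_cases hyx : (y, x) ∈ V
        · exact absurd (hlt y x hyx hxy) (by omega)
        · rw [heq x y (by tauto)] at h
          omega
      · have hzx := hcases z x hz
        have hzy := hcases z y (hz.trans h)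
        have h1 : (x, z) ∈ V := by
          by_contra h0
          exact hc _ _ _ (fun h4 => h0 (hzx.1 h4)) h0 hzz
        have h2 : (z, y) ∈ V := by
          by_contra h0
          exact hc _ _ _ h0 (fun h4 => h0 (hzy.2 h4)) hzz
        exact ht _ _ _ h1 h2

/-! ### Comparison of second moments. -/

theorem sum_range_of_eq_of_ne {m i : ℕ} (hi : i < m) (g : ℕ → ℤ) {a b : ℤ} (ha : g i = a)
    (hb : ∀ k < m, k ≠ i → g k = b) : ∑ k ∈ Finset.range m, g k = a + (m - 1) * b := by
  rw [← Finset.add_sum_erase _ _ (Finset.mem_range.2 hi), ha,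
    Finset.sum_congr rfl (g := fun _ => b)]
  · rw [Finset.sum_const, Finset.card_erase_of_mem (Finset.mem_range.2 hi), Finset.card_range,
      nsmul_eq_mul, Nat.cast_sub (by omega), Nat.cast_one]
  · intro k hk
    rw [Finset.mem_erase, Finset.mem_range] at hk
    exact hb k hk.2 hk.1

theorem sum_range_of_eq_of_eq_of_ne {m i j : ℕ} (hi : i < m) (hj : j < m) (hij : i ≠ j)
    (g : ℕ → ℤ) {a b c : ℤ} (ha : g i = a) (hb : g j = b)
    (hc : ∀ k < m, k ≠ i → k ≠ j → g k = c) :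
    ∑ k ∈ Finset.range m, g k = a + b + (m - 2) * c := by
  have h := sum_range_of_eq_of_ne hj (fun k => if k = i then c else g k) (a := b) (b := c)
    (by simp [hij.symm, hb]) (fun k hk hkj => by
      by_cases hki : k = i
      · simp [hki]
      · simp [hki, hc k hk hki hkj])
  have h' := Finset.add_sum_erase _ g (Finset.mem_range.2 hi)
  have h'' := Finset.add_sum_erase _ (fun k => if k = i then c else g k) (Finset.mem_range.2 hi)
  rw [h, Finset.sum_congr rfl (g := g)] at h''
  · simp only [if_true] at h''
    rw [← h', ha]
    linarith
  · intro k hk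
    rw [Finset.mem_erase] at hk
    simp [hk.1]

theorem two_mul_sum_range_cast (m : ℕ) :
    2 * ∑ j ∈ Finset.range m, (j : ℤ) = m * (m - 1) := by
  induction m with
  | zero => simp
  | succ m ih =>
    rw [Finset.sum_range_succ, mul_add, ih]
    push_cast
    ring

/-- The difference of the second moments of the major index and of the inversion number, for a
family of exchangeable random relations between positions. -/
theorem sum_sq_maj_sub_sum_sq_inv {Ω : Type*} (s : Finset Ω) (u : ℕ → ℕ → Ω → ℤ) (M : ℕ)
    {a₂ ao ai ap a₄ : ℤ}
    (h₂ : ∀ i j, i < M → j < M → i ≠ j → ∑ w ∈ s, u i j w * u i j w = a₂)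
    (ho : ∀ i j k, i < M → j < M → k < M → i ≠ j → i ≠ k → j ≠ k →
      ∑ w ∈ s, u i j w * u i k w = ao)
    (hi : ∀ i j k, i < M → j < M → k < M → i ≠ j → i ≠ k → j ≠ k →
      ∑ w ∈ s, u i j w * u k j w = ai)
    (hp : ∀ i j k, i < M → j < M → k < M → i ≠ j → i ≠ k → j ≠ k →
      ∑ w ∈ s, u i j w * u j k w = ap)
    (h₄ : ∀ i j k l, i < M → j < M → k < M → l < M → i ≠ j → i ≠ k → i ≠ l → j ≠ k → j ≠ l →
      k ≠ l → ∑ w ∈ s, u i j w * u k l w = a₄) (m : ℕ) (hm : m ≤ M) :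
    ∑ w ∈ s, (∑ j ∈ Finset.range m, (j : ℤ) * u (j - 1) j w) ^ 2 -
      ∑ w ∈ s, (∑ j ∈ Finset.range m, ∑ i ∈ Finset.range j, u i j w) ^ 2 =
      (∑ j ∈ Finset.range m, (j : ℤ) * (j - 1)) * (a₂ + ap - ai - ao) := by
  induction m with
  | zero => simp
  | succ m ih =>
    have hmM : m < M := hm
    have ih := ih hmM.le
    -- Passing to `m + 1` adds the column of arcs into `m` to the inversion number and one weighted
    -- arc to the major index. Two arcs share their source (`ao`) or target (`ai`), form a path
    -- (`ap`), or are disjoint (`a₄`); the `a₄` terms cancel, leaving `m * (m - 1)` times the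
    -- defect.
    have hN : ∑ w ∈ s, (∑ i ∈ Finset.range m, u i m w) ^ 2 = m * (a₂ + (m - 1) * ai) := by
      simp only [sq, Finset.sum_mul_sum]
      rw [Finset.sum_comm, Finset.sum_congr rfl (g := fun _ => a₂ + ((m : ℤ) - 1) * ai)]
      · simp
      · intro i him
        rw [Finset.mem_range] at him
        rw [Finset.sum_comm]
        exact sum_range_of_eq_of_ne him _ (h₂ i m (by omega) hmM (by omega))
          fun k hk hki => hi i m k (by omega) hmM (by omega) (by omega) hki.symm (by omega)
    have hIN : ∑ w ∈ s, (∑ j ∈ Finset.range m, ∑ i ∈ Finset.range j, u i j w) *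
        (∑ k ∈ Finset.range m, u k m w) =
        (∑ j ∈ Finset.range m, (j : ℤ)) * (ao + ap + (m - 2) * a₄) := by
      simp only [Finset.sum_mul]
      rw [Finset.sum_comm]
      refine Finset.sum_congr rfl fun j hj => ?_
      rw [Finset.mem_range] at hj
      rw [Finset.sum_comm, Finset.sum_congr rfl (g := fun _ => ao + ap + ((m : ℤ) - 2) * a₄)]
      · simp
      · intro i hij
        rw [Finset.mem_range] at hij
        simp only [Finset.mul_sum]
        rw [Finset.sum_comm]
        exact sum_range_of_eq_of_eq_of_ne (hij.trans hj) hj hij.ne _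
          (ho i j m (by omega) (by omega) hmM (by omega) (by omega) (by omega))
          (hp i j m (by omega) (by omega) hmM (by omega) (by omega) (by omega))
          fun k hk hki hkj => h₄ i j k m (by omega) (by omega) (by omega) hmM (by omega)
            (by omega) (by omega) (by omega) (by omega) (by omega)
    have hJ : ∑ w ∈ s, ((m : ℤ) * u (m - 1) m w) ^ 2 = m ^ 2 * a₂ := by
      rcases Nat.eq_zero_or_pos m with rfl | hpos
      · simp
      · simp only [mul_pow]
        rw [← Finset.mul_sum, ← h₂ (m - 1) m (by omega) hmM (by omega)]
        simp only [sq]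
    have hJN : 2 * ∑ w ∈ s, (∑ j ∈ Finset.range m, (j : ℤ) * u (j - 1) j w) *
        ((m : ℤ) * u (m - 1) m w) = m * (2 * (m - 1) * ap + (m - 1) * (m - 2) * a₄) := by
      rcases m with _ | m
      · simp
      · simp only [Nat.add_sub_cancel]
        have e : ∑ w ∈ s, (∑ j ∈ Finset.range (m + 1), (j : ℤ) * u (j - 1) j w) *
            (((m + 1 : ℕ) : ℤ) * u m (m + 1) w) = ((m + 1 : ℕ) : ℤ) *
            ∑ j ∈ Finset.range (m + 1), (j : ℤ) * ∑ w ∈ s, u (j - 1) j w * u m (m + 1) w := by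
          simp only [Finset.sum_mul, Finset.mul_sum]
          rw [Finset.sum_comm]
          exact Finset.sum_congr rfl fun j _ => Finset.sum_congr rfl fun w _ => by ring
        have e1 : ∑ j ∈ Finset.range m, (j : ℤ) * ∑ w ∈ s, u (j - 1) j w * u m (m + 1) w =
            (∑ j ∈ Finset.range m, (j : ℤ)) * a₄ := by
          rw [Finset.sum_mul]
          refine Finset.sum_congr rfl fun j hj => ?_
          rw [Finset.mem_range] at hj
          rcases Nat.eq_zero_or_pos j with rfl | hpos
          · simp
          · rw [h₄ (j - 1) j m (m + 1) (by omega) (by omega) (by omega) (by omega) (by omega)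
              (by omega) (by omega) (by omega) (by omega) (by omega)]
        have e2 : (m : ℤ) * ∑ w ∈ s, u (m - 1) m w * u m (m + 1) w = m * ap := by
          rcases Nat.eq_zero_or_pos m with rfl | hpos
          · simp
          · rw [hp (m - 1) m (m + 1) (by omega) (by omega) (by omega) (by omega) (by omega)
              (by omega)]
        rw [e, Finset.sum_range_succ, e1, e2]
        have := two_mul_sum_range_cast m
        push_cast
        linear_combination ((m : ℤ) + 1) * a₄ * this
    have hS := two_mul_sum_range_cast m
    simp only [Finset.sum_range_succ, add_sq, Finset.sum_add_distrib]
    simp only [mul_assoc, ← Finset.mul_sum]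
    rw [hN, hIN, hJ, hJN]
    linear_combination ih - (ao + ap + ((m : ℤ) - 2) * a₄) * hS

/-! ### Sufficiency: transport of Foata's map, and irrelevance of loops at letters of multiplicity
1. -/

open Classical in
theorem graphInv_reverse {n : ℕ} (V : Set (Fin n × Fin n)) (l : List (Fin n)) :
    graphInv V l.reverse = revInv (fun a b => (a, b) ∈ V) l := by
  induction l with
  | nil => simp [graphInv, revInv]
  | cons x w ih =>
    rw [List.reverse_cons, graphInv_append_singleton, sum_pairInd_append_singleton, ih, revInv,
      List.countP_reverse, add_comm]

open Classical in
theorem graphMaj_reverse {n : ℕ} (V : Set (Fin n × Fin n)) (l : List (Fin n)) :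
    graphMaj V l.reverse = revMaj (fun a b => (a, b) ∈ V) l := by
  induction l with
  | nil => simp [graphMaj, graphDes, revMaj]
  | cons x w ih =>
    rw [List.reverse_cons, graphMaj_append_singleton, ih]
    cases w with
    | nil => simp [revMaj]
    | cons a t =>
      rw [revMaj, add_comm]
      congr 1
      simp [pairInd]

theorem mem_rearrangementClass_of_perm {n : ℕ} {α : Fin n → ℕ} {w w' : List (Fin n)}
    (h : w'.Perm w) (hw : w ∈ RearrangementClass α) : w' ∈ RearrangementClass α := fun x =>
  (h.count_eq x).trans (hw x)

/-- If a relation and its complement are transitive, Foata's bijection shows that its inversion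
number and its major index are equidistributed. -/
theorem equidistributedOn_of_transitive {n : ℕ} (α : Fin n → ℕ) {V : Set (Fin n × Fin n)}
    (ht : ∀ x y z, (x, y) ∈ V → (y, z) ∈ V → (x, z) ∈ V)
    (hc : ∀ x y z, (x, y) ∉ V → (y, z) ∉ V → (x, z) ∉ V) :
    EquidistributedOn (graphInv V) (graphMaj V) (RearrangementClass α) := by
  classical
  let F : List (Fin n) → List (Fin n) := fun w =>
    (foataMap (fun a b => (a, b) ∈ V) w.reverse).reverse
  have hFperm : ∀ w, (F w).Perm w := fun w =>
    (List.reverse_perm _).trans ((foataMap_perm _ _).trans (List.reverse_perm _))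
  have hFinj : Function.Injective F := fun w w' h =>
    List.reverse_injective (foataMap_injective _ (List.reverse_injective h))
  have hF : ∀ w, graphInv V (F w) = graphMaj V w := fun w => by
    rw [graphInv_reverse, revInv_foataMap _ ht hc, ← graphMaj_reverse, List.reverse_reverse]
  have hmaps : ∀ w ∈ RearrangementClass α, F w ∈ RearrangementClass α := fun w hw =>
    mem_rearrangementClass_of_perm (hFperm w) hw
  have hsurj : F '' RearrangementClass α = RearrangementClass α :=
    Set.eq_of_subset_of_ncard_le (Set.image_subset_iff.2 hmaps)
      (Set.ncard_image_of_injective _ hFinj).ge (rearrangementClass_finite α)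
  intro k
  have himage : {w ∈ RearrangementClass α | graphInv V w = k} =
      F '' {w ∈ RearrangementClass α | graphMaj V w = k} := by
    ext w
    constructor
    · rintro ⟨hw, hk⟩
      rw [← hsurj] at hw
      obtain ⟨v, hv, rfl⟩ := hw
      exact ⟨v, ⟨hv, (hF v).symm.trans hk⟩, rfl⟩
    · rintro ⟨v, ⟨hv, hk⟩, rfl⟩
      exact ⟨hmaps v hv, (hF v).trans hk⟩
  rw [himage, Set.ncard_image_of_injective _ hFinj]

theorem pairInd_congr_of_mem_rearrangementClass {n : ℕ} {α : Fin n → ℕ}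
    {U V : Set (Fin n × Fin n)} (h : ∀ x y, ((x, y) ∈ U ↔ (x, y) ∈ V) ∨ x = y ∧ α x = 1)
    {w : List (Fin n)} (hw : w ∈ RearrangementClass α) {i j : ℕ} (hij : i < j) :
    pairInd U w i j = pairInd V w i j := by
  unfold pairInd
  congr 1
  refine propext (exists_congr fun a => exists_congr fun b => and_congr_right fun ha =>
    and_congr_right fun hb => ?_)
  rcases h a b with hab | ⟨rfl, h1⟩
  · exact hab
  · exfalso
    rw [List.getElem?_eq_some_iff] at ha hb
    obtain ⟨hi, ha⟩ := ha
    obtain ⟨hj, hb⟩ := hb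
    have hdup : List.Duplicate a w := by
      rw [List.duplicate_iff_exists_distinct_get]
      exact ⟨⟨i, hi⟩, ⟨j, hj⟩, hij, ha.symm, hb.symm⟩
    rw [List.duplicate_iff_two_le_count, hw a] at hdup
    omega

theorem graphInv_congr_of_mem_rearrangementClass {n : ℕ} {α : Fin n → ℕ}
    {U V : Set (Fin n × Fin n)} (h : ∀ x y, ((x, y) ∈ U ↔ (x, y) ∈ V) ∨ x = y ∧ α x = 1)
    {w : List (Fin n)} (hw : w ∈ RearrangementClass α) : graphInv U w = graphInv V w := by
  rw [graphInv_eq_sum_pairInd, graphInv_eq_sum_pairInd]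
  exact Finset.sum_congr rfl fun j _ => Finset.sum_congr rfl fun i hi =>
    pairInd_congr_of_mem_rearrangementClass h hw (Finset.mem_range.1 hi)

theorem graphMaj_congr_of_mem_rearrangementClass {n : ℕ} {α : Fin n → ℕ}
    {U V : Set (Fin n × Fin n)} (h : ∀ x y, ((x, y) ∈ U ↔ (x, y) ∈ V) ∨ x = y ∧ α x = 1)
    {w : List (Fin n)} (hw : w ∈ RearrangementClass α) : graphMaj U w = graphMaj V w := by
  rw [graphMaj_eq_sum_pairInd, graphMaj_eq_sum_pairInd]
  refine Finset.sum_congr rfl fun j _ => ?_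
  rcases Nat.eq_zero_or_pos j with rfl | hj
  · simp
  · rw [pairInd_congr_of_mem_rearrangementClass h hw (by omega)]

theorem EquidistributedOn.congr {n : ℕ} {f g f' g' : List (Fin n) → ℕ} {R : Set (List (Fin n))}
    (h : EquidistributedOn f g R) (hf : ∀ w ∈ R, f' w = f w) (hg : ∀ w ∈ R, g' w = g w) :
    EquidistributedOn f' g' R := by
  intro k
  have e1 : {w ∈ R | f' w = k} = {w ∈ R | f w = k} :=
    Set.ext fun w => and_congr_right fun hw => by rw [hf w hw]
  have e2 : {w ∈ R | g' w = k} = {w ∈ R | g w = k} :=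
    Set.ext fun w => and_congr_right fun hw => by rw [hg w hw]
  rw [e1, e2, h k]

theorem IsEssentiallyBipartitional.equidistributedOn {n : ℕ} {α : Fin n → ℕ}
    {U : Set (Fin n × Fin n)} (h : IsEssentiallyBipartitional α U) :
    EquidistributedOn (graphInv U) (graphMaj U) (RearrangementClass α) := by
  obtain ⟨I, J, -, h1, hV⟩ := h
  rw [isBipartitional_iff_transitive] at hV
  have hUV : ∀ x y, ((x, y) ∈ U ↔
      (x, y) ∈ (U \ {p | ∃ x ∈ I, p = (x, x)}) ∪ {p | ∃ x ∈ J, p = (x, x)}) ∨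
        x = y ∧ α x = 1 := by
    intro x y
    by_cases hx : x = y ∧ x ∈ I ∪ J
    · exact Or.inr ⟨hx.1, h1 x hx.2⟩
    · left
      simp only [Set.mem_union, Set.mem_sdiff, Set.mem_ofPred_eq, Prod.mk.injEq]
      constructor
      · intro hU
        refine Or.inl ⟨hU, ?_⟩
        rintro ⟨z, hz, rfl, rfl⟩
        exact hx ⟨rfl, Or.inl hz⟩
      · rintro (hU | ⟨z, hz, rfl, rfl⟩)
        · exact hU.1
        · exact absurd ⟨rfl, Or.inr hz⟩ hx
  exact (equidistributedOn_of_transitive α hV.1 hV.2).congr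
    (fun w hw => graphInv_congr_of_mem_rearrangementClass hUV hw)
    (fun w hw => graphMaj_congr_of_mem_rearrangementClass hUV hw)

/-! ### Necessity: exchangeability and the triple defect. -/

theorem EquidistributedOn.sum_eq {n : ℕ} {f g : List (Fin n) → ℕ} {R : Set (List (Fin n))}
    (hR : R.Finite) (h : EquidistributedOn f g R) {M : Type*} [AddCommMonoid M] (G : ℕ → M) :
    ∑ w ∈ hR.toFinset, G (f w) = ∑ w ∈ hR.toFinset, G (g w) := by
  have hmap : hR.toFinset.val.map f = hR.toFinset.val.map g := by
    ext k
    have hcount : ∀ f : List (Fin n) → ℕ,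
        (hR.toFinset.val.map f).count k = {w ∈ R | f w = k}.ncard := by
      intro f
      have e : {w ∈ R | f w = k} = ((hR.toFinset.filter fun w => k = f w : Finset _) : Set _) := by
        ext w
        simp [eq_comm]
      rw [Multiset.count_map, e, Set.ncard_coe_finset, ← Finset.filter_val, Finset.card_val]
    rw [hcount, hcount, h k]
  have := congrArg (fun m => (m.map G).sum) hmap
  simp only [Multiset.map_map] at this
  exact this

/-- The positions of a random word of a rearrangement class are exchangeable. -/
theorem sum_rearrangementClass_exchangeable {n : ℕ} {α : Fin n → ℕ} {M k : ℕ}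
    (hM : ∀ w ∈ RearrangementClass α, w.length = M) (e e' : Fin k → ℕ)
    (he : Function.Injective e) (he' : Function.Injective e') (heM : ∀ a, e a < M)
    (heM' : ∀ a, e' a < M) (G : (Fin k → Option (Fin n)) → ℤ) :
    ∑ w ∈ (rearrangementClass_finite α).toFinset, G (fun a => w[e a]?) =
      ∑ w ∈ (rearrangementClass_finite α).toFinset, G (fun a => w[e' a]?) := by
  classical
  have hsum : ∀ H : List (Fin n) → ℤ, ∑ w ∈ (rearrangementClass_finite α).toFinset, H w =
      ∑ v : Fin M → Fin n with List.ofFn v ∈ RearrangementClass α, H (List.ofFn v) := by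
    intro H
    symm
    refine Finset.sum_bij (fun v _ => List.ofFn v) ?_ ?_ ?_ ?_
    · intro v hv
      simpa using hv
    · intro v _ v' _ h
      exact List.ofFn_injective h
    · intro w hw
      have hw : w ∈ RearrangementClass α := by simpa using hw
      obtain rfl := hM w hw
      refine ⟨fun i => w.get i, ?_, List.ofFn_get w⟩
      rw [Finset.mem_filter, List.ofFn_get]
      exact ⟨Finset.mem_univ _, hw⟩
    · intro v _
      rfl
  let E : Fin k ↪ Fin M := ⟨fun a => ⟨e a, heM a⟩, fun a b h => he (by simpa using h)⟩
  let E' : Fin k ↪ Fin M := ⟨fun a => ⟨e' a, heM' a⟩, fun a b h => he' (by simpa using h)⟩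
  have := Equiv.Perm.isMultiplyPretransitive (Fin M) k
  -- The symmetric group is `k`-fold transitive on positions, and permuting positions preserves the
  -- rearrangement class.
  obtain ⟨π, hπ⟩ := MulAction.exists_smul_eq (Equiv.Perm (Fin M)) E' E
  have hπ : ∀ a, π (E' a) = E a := fun a => by
    rw [← hπ]
    rfl
  have hget : ∀ (v : Fin M → Fin n) (i : Fin M), (List.ofFn v)[(i : ℕ)]? = some (v i) := by
    intro v i
    simp
  rw [hsum, hsum]
  refine Finset.sum_equiv (Equiv.arrowCongr π.symm (Equiv.refl _)) ?_ ?_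
  · intro v
    have hperm : (List.ofFn (v ∘ π)).Perm (List.ofFn v) := Equiv.Perm.ofFn_comp_perm π v
    simp only [Finset.mem_filter, Finset.mem_univ, true_and]
    exact ⟨mem_rearrangementClass_of_perm hperm, mem_rearrangementClass_of_perm hperm.symm⟩
  · intro v _
    refine congrArg G (funext fun a => ?_)
    change (List.ofFn v)[(E a : ℕ)]? = (List.ofFn (v ∘ π))[(E' a : ℕ)]?
    rw [hget, hget, Function.comp, hπ]

open Classical in
/-- The indicator of a relation, extended by zero to missing letters. -/
noncomputable def optionInd {n : ℕ} (U : Set (Fin n × Fin n)) (a b : Option (Fin n)) : ℤ :=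
  if ∃ x y, a = some x ∧ b = some y ∧ (x, y) ∈ U then 1 else 0

theorem optionInd_eq_zero_or_one {n : ℕ} (U : Set (Fin n × Fin n)) (a b : Option (Fin n)) :
    optionInd U a b = 0 ∨ optionInd U a b = 1 := by
  unfold optionInd
  split_ifs <;> simp

theorem optionInd_getElem? {n : ℕ} (U : Set (Fin n × Fin n)) (w : List (Fin n)) (i j : ℕ) :
    optionInd U w[i]? w[j]? = (pairInd U w i j : ℤ) := by
  simp [optionInd, pairInd]

/-- The contribution of an ordered triple of letters to the difference of the second moments of
the major index and of the inversion number. -/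
noncomputable def tripleDefect {n : ℕ} (U : Set (Fin n × Fin n)) (a b c : Option (Fin n)) : ℤ :=
  optionInd U a b * optionInd U a b + optionInd U a b * optionInd U b c -
    optionInd U a b * optionInd U c b - optionInd U a b * optionInd U a c

theorem sum_tripleDefect_eq_zero {n : ℕ} {α : Fin n → ℕ} {U : Set (Fin n × Fin n)}
    (h : EquidistributedOn (graphInv U) (graphMaj U) (RearrangementClass α)) {M : ℕ}
    (hM : ∀ w ∈ RearrangementClass α, w.length = M) {i j k : ℕ} (hi : i < M) (hj : j < M)
    (hk : k < M) (hij : i ≠ j) (hik : i ≠ k) (hjk : j ≠ k) :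
    ∑ w ∈ (rearrangementClass_finite α).toFinset, tripleDefect U w[i]? w[j]? w[k]? = 0 := by
  set s := (rearrangementClass_finite α).toFinset with hs
  let u : ℕ → ℕ → List (Fin n) → ℤ := fun i j w => optionInd U w[i]? w[j]?
  have hex3 : ∀ (G : (Fin 3 → Option (Fin n)) → ℤ) (i' j' k' : ℕ), i' < M → j' < M → k' < M →
      i' ≠ j' → i' ≠ k' → j' ≠ k' → ∑ w ∈ s, G (fun a => w[![i', j', k'] a]?) =
        ∑ w ∈ s, G (fun a => w[![i, j, k] a]?) := by
    intro G i' j' k' hi' hj' hk' h1 h2 h3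
    refine sum_rearrangementClass_exchangeable hM _ _ ?_ ?_ ?_ ?_ G
    · intro a b
      fin_cases a <;> fin_cases b <;> simp [*, Ne.symm]
    · intro a b
      fin_cases a <;> fin_cases b <;> simp [*, Ne.symm]
    · intro a
      fin_cases a <;> simp [*]
    · intro a
      fin_cases a <;> simp [*]
  have h2 : ∀ i' j', i' < M → j' < M → i' ≠ j' → ∑ w ∈ s, u i' j' w * u i' j' w =
      ∑ w ∈ s, u i j w * u i j w := by
    intro i' j' hi' hj' hij'
    refine sum_rearrangementClass_exchangeable hM ![i', j'] ![i, j] ?_ ?_ ?_ ?_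
      (fun v => optionInd U (v 0) (v 1) * optionInd U (v 0) (v 1))
    · intro a b
      fin_cases a <;> fin_cases b <;> simp [hij', hij'.symm]
    · intro a b
      fin_cases a <;> fin_cases b <;> simp [hij, hij.symm]
    · intro a
      fin_cases a <;> simp [hi', hj']
    · intro a
      fin_cases a <;> simp [hi, hj]
  have h4 : ∃ a₄, ∀ i j k l, i < M → j < M → k < M → l < M → i ≠ j → i ≠ k → i ≠ l → j ≠ k →
      j ≠ l → k ≠ l → ∑ w ∈ s, u i j w * u k l w = a₄ := by
    -- The reference positions 0, 1, 2, 3 may exceed the word, but then there are no four distinct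
    -- positions and the claim is vacuous.
    refine ⟨∑ w ∈ s, u 0 1 w * u 2 3 w, ?_⟩
    intro i j k l hi hj hk hl hij hik hil hjk hjl hkl
    refine sum_rearrangementClass_exchangeable hM ![i, j, k, l] ![0, 1, 2, 3] ?_ ?_ ?_ ?_
      (fun v => optionInd U (v 0) (v 1) * optionInd U (v 2) (v 3))
    · intro a b
      fin_cases a <;> fin_cases b <;>
        simp [hij, hik, hil, hjk, hjl, hkl, hij.symm, hik.symm, hil.symm, hjk.symm, hjl.symm,
          hkl.symm]
    · decide
    · intro a
      fin_cases a <;> simp [*]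
    · intro a
      fin_cases a <;> simp <;> omega
  obtain ⟨a₄, h4⟩ := h4
  have hmoment := sum_sq_maj_sub_sum_sq_inv s u M h2
    (fun i' j' k' => hex3 (fun v => optionInd U (v 0) (v 1) * optionInd U (v 0) (v 2)) i' j' k')
    (fun i' j' k' => hex3 (fun v => optionInd U (v 0) (v 1) * optionInd U (v 2) (v 1)) i' j' k')
    (fun i' j' k' => hex3 (fun v => optionInd U (v 0) (v 1) * optionInd U (v 1) (v 2)) i' j' k')
    h4 M le_rfl
  have hmaj : ∑ w ∈ s, (∑ j ∈ Finset.range M, (j : ℤ) * u (j - 1) j w) ^ 2 =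
      ∑ w ∈ s, (graphMaj U w : ℤ) ^ 2 := by
    refine Finset.sum_congr rfl fun w hw => ?_
    rw [graphMaj_eq_sum_pairInd, hM w (by simpa [hs] using hw)]
    simp only [u, optionInd_getElem?]
    push_cast
    rfl
  have hinv : ∑ w ∈ s, (∑ j ∈ Finset.range M, ∑ i ∈ Finset.range j, u i j w) ^ 2 =
      ∑ w ∈ s, (graphInv U w : ℤ) ^ 2 := by
    refine Finset.sum_congr rfl fun w hw => ?_
    rw [graphInv_eq_sum_pairInd, hM w (by simpa [hs] using hw)]
    simp only [u, optionInd_getElem?]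
    push_cast
    rfl
  rw [hmaj, hinv, h.sum_eq (rearrangementClass_finite α) (fun m => (m : ℤ) ^ 2),
    sub_self] at hmoment
  -- Three distinct positions force `M ≥ 3`, so the term `j = 2` is present.
  have hpos : 0 < ∑ j ∈ Finset.range M, (j : ℤ) * (j - 1) := by
    refine Finset.sum_pos' (fun j _ => ?_) ⟨2, Finset.mem_range.2 (by omega), by norm_num⟩
    rcases j with _ | j
    · simp
    · exact mul_nonneg (by positivity) (by push_cast; linarith [Nat.cast_nonneg (α := ℤ) j])
  have := (mul_eq_zero.1 hmoment.symm).resolve_left hpos.ne'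
  simp only [tripleDefect, Finset.sum_sub_distrib, Finset.sum_add_distrib]
  exact this

/-- The sum of `tripleDefect` over the orderings of a triple. -/
noncomputable def symmTripleDefect {n : ℕ} (U : Set (Fin n × Fin n)) (a b c : Option (Fin n)) :
    ℤ :=
  tripleDefect U a b c + tripleDefect U a c b + tripleDefect U b a c + tripleDefect U b c a +
    tripleDefect U c a b + tripleDefect U c b a

/-- A finite check over the six indicators. The symmetrisation is essential: a single `tripleDefect`
can be negative. -/
theorem symmTripleDefect_nonneg {n : ℕ} (U : Set (Fin n × Fin n)) (a b c : Option (Fin n)) :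
    0 ≤ symmTripleDefect U a b c := by
  unfold symmTripleDefect tripleDefect
  rcases optionInd_eq_zero_or_one U a b with h1 | h1 <;>
  rcases optionInd_eq_zero_or_one U b a with h2 | h2 <;>
  rcases optionInd_eq_zero_or_one U a c with h3 | h3 <;>
  rcases optionInd_eq_zero_or_one U c a with h4 | h4 <;>
  rcases optionInd_eq_zero_or_one U b c with h5 | h5 <;>
  rcases optionInd_eq_zero_or_one U c b with h6 | h6 <;>
  simp [h1, h2, h3, h4, h5, h6]

theorem transitive_of_symmTripleDefect_eq_zero {n : ℕ} {U : Set (Fin n × Fin n)} {x y z : Fin n}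
    (h : symmTripleDefect U (some x) (some y) (some z) = 0) :
    ((x, y) ∈ U → (y, z) ∈ U → (x, z) ∈ U) ∧ ((x, y) ∉ U → (y, z) ∉ U → (x, z) ∉ U) := by
  unfold symmTripleDefect tripleDefect optionInd at h
  by_cases h1 : (x, y) ∈ U <;> by_cases h2 : (y, x) ∈ U <;> by_cases h3 : (x, z) ∈ U <;>
  by_cases h4 : (z, x) ∈ U <;> by_cases h5 : (y, z) ∈ U <;> by_cases h6 : (z, y) ∈ U <;>
  simp [h1, h2, h3, h4, h5, h6] at h ⊢

/-- The symmetrised defects at the first three positions sum to zero over all words and are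
nonnegative, so each vanishes. The three letters need not be distinct. -/
theorem EquidistributedOn.transitive_of_mem {n : ℕ} {α : Fin n → ℕ} {U : Set (Fin n × Fin n)}
    (h : EquidistributedOn (graphInv U) (graphMaj U) (RearrangementClass α)) {x y z : Fin n}
    {l : List (Fin n)} (hl : x :: y :: z :: l ∈ RearrangementClass α) :
    ((x, y) ∈ U → (y, z) ∈ U → (x, z) ∈ U) ∧ ((x, y) ∉ U → (y, z) ∉ U → (x, z) ∉ U) := by
  have hM : ∀ w ∈ RearrangementClass α, w.length = l.length + 3 := fun w hw =>
    (List.perm_iff_count.2 fun a => (hw a).trans (hl a).symm).length_eq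
  have hsum : ∑ w ∈ (rearrangementClass_finite α).toFinset,
      symmTripleDefect U w[0]? w[1]? w[2]? = 0 := by
    simp only [symmTripleDefect, Finset.sum_add_distrib]
    simp [sum_tripleDefect_eq_zero h hM]
  rw [Finset.sum_eq_zero_iff_of_nonneg fun w _ => symmTripleDefect_nonneg U _ _ _] at hsum
  exact transitive_of_symmTripleDefect_eq_zero
    (by simpa using hsum _ ((Set.Finite.mem_toFinset _).2 hl))

/-! ### Necessity: from triples of letters to a bipartitional relation. -/

theorem exists_append_mem_rearrangementClass {n : ℕ} {α : Fin n → ℕ} {l : List (Fin n)}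
    (h : ∀ a, l.count a ≤ α a) : ∃ t, l ++ t ∈ RearrangementClass α := by
  refine ⟨(∑ x, Multiset.replicate (α x - l.count x) x : Multiset (Fin n)).toList, fun a => ?_⟩
  rw [List.count_append, ← Multiset.coe_count a (Multiset.toList _), Multiset.coe_toList,
    Multiset.count_sum']
  simp [Multiset.count_replicate, h a]

theorem EquidistributedOn.isEssentiallyBipartitional {n : ℕ} {α : Fin n → ℕ}
    {U : Set (Fin n × Fin n)} (hα : ∀ x, 1 ≤ α x)
    (h : EquidistributedOn (graphInv U) (graphMaj U) (RearrangementClass α)) :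
    IsEssentiallyBipartitional α U := by
  classical
  have htriple : ∀ x y z, (∀ a, [x, y, z].count a ≤ α a) →
      ((x, y) ∈ U → (y, z) ∈ U → (x, z) ∈ U) ∧ ((x, y) ∉ U → (y, z) ∉ U → (x, z) ∉ U) := by
    intro x y z hle
    obtain ⟨t, ht⟩ := exists_append_mem_rearrangementClass hle
    exact h.transitive_of_mem ht
  have hdistinct : ∀ x y z, x ≠ y → x ≠ z → y ≠ z →
      ((x, y) ∈ U → (y, z) ∈ U → (x, z) ∈ U) ∧ ((x, y) ∉ U → (y, z) ∉ U → (x, z) ∉ U) :=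
    fun x y z hxy hxz hyz => htriple x y z fun a =>
      (List.nodup_iff_count_le_one.1 (by simp [hxy, hxz, hyz]) a).trans (hα a)
  have hloop : ∀ x y, x ≠ y → α x ≠ 1 →
      ((x, y) ∈ U → (y, x) ∈ U → (x, x) ∈ U) ∧ ((x, y) ∉ U → (y, x) ∉ U → (x, x) ∉ U) := by
    intro x y hxy hx
    refine htriple x y x fun a => ?_
    have h1 := hα a
    have h2 := hα x
    by_cases hxa : x = a
    · subst hxa
      simp [hxy.symm]
      omega
    · by_cases hya : y = a
      · subst hya
        simpa [List.count_cons, hxy] using h1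
      · simp [hxa, hya]
  -- Transitivity forces a loop at every letter having a mutual neighbour; the other letters of
  -- multiplicity 1 lose theirs.
  let J : Set (Fin n) := {x | α x = 1 ∧ ∃ y, y ≠ x ∧ (x, y) ∈ U ∧ (y, x) ∈ U}
  let I : Set (Fin n) := {x | α x = 1 ∧ x ∉ J}
  refine ⟨I, J, Set.disjoint_left.2 fun x hx => hx.2, ?_, ?_⟩
  · rintro x (hx | hx)
    · exact hx.1
    · exact hx.1
  rw [isBipartitional_iff_transitive]
  set V := (U \ {p | ∃ x ∈ I, p = (x, x)}) ∪ {p | ∃ x ∈ J, p = (x, x)} with hV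
  have hne : ∀ x y, x ≠ y → ((x, y) ∈ V ↔ (x, y) ∈ U) := by
    intro x y hxy
    simp only [hV, Set.mem_union, Set.mem_sdiff, Set.mem_ofPred_eq, Prod.mk.injEq]
    constructor
    · rintro (hU | ⟨z, -, rfl, rfl⟩)
      · exact hU.1
      · exact absurd rfl hxy
    · intro hU
      refine Or.inl ⟨hU, ?_⟩
      rintro ⟨z, -, rfl, rfl⟩
      exact hxy rfl
  have hone : ∀ x, α x = 1 → ((x, x) ∈ V ↔ x ∈ J) := by
    intro x hx
    simp only [hV, Set.mem_union, Set.mem_sdiff, Set.mem_ofPred_eq, Prod.mk.injEq, and_self,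
      exists_eq_right']
    refine ⟨?_, Or.inr⟩
    rintro (hU | hJ)
    · by_contra hJ
      exact hU.2 ⟨hx, hJ⟩
    · exact hJ
  have hmany : ∀ x, α x ≠ 1 → ((x, x) ∈ V ↔ (x, x) ∈ U) := by
    intro x hx
    have hI : x ∉ I := fun h => hx h.1
    have hJ : x ∉ J := fun h => hx h.1
    simp [hV, hI, hJ]
  constructor
  · intro x y z hxy hyz
    by_cases h1 : x = y
    · exact h1 ▸ hyz
    by_cases h2 : y = z
    · exact h2 ▸ hxy
    rw [hne _ _ h1] at hxy
    rw [hne _ _ h2] at hyz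
    by_cases h3 : x = z
    · subst h3
      by_cases hx : α x = 1
      · exact (hone x hx).2 ⟨hx, y, h2, hxy, hyz⟩
      · exact (hmany x hx).2 ((hloop x y h1 hx).1 hxy hyz)
    · exact (hne _ _ h3).2 ((hdistinct x y z h1 h3 h2).1 hxy hyz)
  · intro x y z hxy hyz
    by_cases h1 : x = y
    · exact h1 ▸ hyz
    by_cases h2 : y = z
    · exact h2 ▸ hxy
    rw [hne _ _ h1] at hxy
    rw [hne _ _ h2] at hyz
    by_cases h3 : x = z
    · subst h3
      by_cases hx : α x = 1
      · rw [hone x hx]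
        -- The choice of `J` respects the complement: a mutual neighbour `w` of `x` and a letter `y`
        -- unrelated to `x` both ways would violate one of the transitivities on the distinct
        -- letters `x`, `w`, `y`.
        rintro ⟨-, w, hwx, hxw, hwx'⟩
        have hwy : w ≠ y := fun h => hxy (h ▸ hxw)
        have hwy' : (w, y) ∉ U := fun h0 => hxy ((hdistinct x w y hwx.symm h1 hwy).1 hxw h0)
        exact (hdistinct w y x hwy hwx h2).2 hwy' hyz hwx'
      · exact fun h0 => (hloop x y h1 hx).2 hxy hyz ((hmany x hx).1 h0)
    · exact fun h0 => (hdistinct x y z h1 h3 h2).2 hxy hyz ((hne _ _ h3).1 h0)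

theorem theorem2 {n : ℕ} (α : Fin n → ℕ) (U : Set (Fin n × Fin n)) :
    (IsEssentiallyBipartitional α U →
      EquidistributedOn (graphInv U) (graphMaj U) (RearrangementClass α)) ∧
    ((∀ x, 1 ≤ α x) →
      (EquidistributedOn (graphInv U) (graphMaj U) (RearrangementClass α) ↔
        IsEssentiallyBipartitional α U)) :=
  ⟨fun h => h.equidistributedOn, fun hα =>
    ⟨fun h => h.isEssentiallyBipartitional hα, fun h => h.equidistributedOn⟩⟩
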